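/- Let $F_q$ be a finite field with $q$ elements, $\chi$ a multiplicative character of $F_q^*$ and $\lambda$ an additive character of $F_q$, both complex valued, and let $G(\chi,\lambda)=\sum_{x\in F_q^*}\chi(x)\lambda(x)$ be the Gauss sum. For $n\ge 1$ put $S_n=\sum_{g\in GL(n,q)}\chi(\det g)\,\lambda(\operatorname{tr} g)$. Then: (1) $$1+\sum_{n=1}^{\infty}\frac{u^n}{|GL(n,q)|}\,S_n=\begin{cases}\dfrac{1}{1-u} & \text{if } \lambda \text{ and } \chi \text{ are trivial},\\[1ex] 1 & \text{if } \lambda \text{ is trivial and } \chi \text{ is nontrivial},\\[1ex] \displaystyle\prod_{i\ge 1}\Bigl(1+\frac{u\,G(\chi,\lambda)}{q^i}\Bigr) & \text{if } \lambda \text{ is nontrivial}.\end{cases}$$ These identities hold both as identities of formal power series in $u$ over $\mathbb{C}$ (the infinite product converging coefficientwise) and as identities of convergent series and products in a complex variable $u$, with $|u|<1$ in the first case and $u\in\mathbb{C}$ arbitrary in the other two. (2) For every $n\ge 1$, $$S_n=\begin{cases}|GL(n,q)| & \text{if } \lambda \text{ and } \chi \text{ are trivial},\\ 0 & \text{if }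 \lambda \text{ is trivial and } \chi \text{ is nontrivial},\\ q^{\binom n2}\,G(\chi,\lambda)^n & \text{if } \lambda \text{ is nontrivial}.\end{cases}$$ -/

import Mathlib

open scoped MatrixGroups PowerSeries PowerSeries.WithPiTopology

noncomputable section

/-- The sum of `χ(det g) ψ(tr g)` over `g ∈ GL(n, F)`. -/
def glGaussSum {F : Type*} [Field F] [Fintype F] [DecidableEq F]
    (χ : MulChar F ℂ) (ψ : AddChar F ℂ) (n : ℕ) : ℂ :=
  ∑ g : GL (Fin n) F, χ (Matrix.det (g : Matrix (Fin n) (Fin n) F)) *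
    ψ (Matrix.trace (g : Matrix (Fin n) (Fin n) F))

/-- The coefficient of `u ^ n` in
`1 + ∑_{n ≥ 1} (u ^ n / |GL(n, F)|) ∑_{g ∈ GL(n, F)} χ(det g) ψ(tr g)`. -/
def glCoeff {F : Type*} [Field F] [Fintype F] [DecidableEq F]
    (χ : MulChar F ℂ) (ψ : AddChar F ℂ) (n : ℕ) : ℂ :=
  if n = 0 then 1 else glGaussSum χ ψ n / (Fintype.card (GL (Fin n) F) : ℂ)

/-- The generating function
`1 + ∑_{n ≥ 1} (u ^ n / |GL(n, F)|) ∑_{g ∈ GL(n, F)} χ(det g) ψ(tr g)`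
as a formal power series in `u`. -/
def glSeries {F : Type*} [Field F] [Fintype F] [DecidableEq F]
    (χ : MulChar F ℂ) (ψ : AddChar F ℂ) : ℂ⟦X⟧ :=
  PowerSeries.mk (glCoeff χ ψ)

end

/-! ### Block decomposition of matrices and an elementary column operation -/

section MatrixBlocks

variable {F : Type*} [Field F]

/-! Since `χ` vanishes at `0`, the sum over `GL` extends to all matrices. Adding multiples of column
`0` to the other columns preserves the determinant and changes the trace by a linear form whose
coefficients are the entries below the corner. Averaging over these operations, orthogonality for `ψ
≠ 1` kills every matrix with a nonzero entry there. What survives is block triangular: the corner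
yields a Gauss sum `G`, the free first row `q ^ n`, and the last block the smaller sum
(`matrixGaussSum_succ`).

Dividing by `|GL(n, q)|` turns this into `(q ^ (n + 1) - 1) a (n + 1) = G a n`, that is, `A(u) = (1
+ u G / q) A(u / q)`. Iterating gives the Euler product, because `A(u / q ^ N)` tends to `a 0 = 1`,
both pointwise and coefficientwise. For trivial `ψ`, translation invariance on the group suffices.
-/

theorem Matrix.det_eq_mul_det_submatrix_of_col_zero {n : ℕ}
    {M : Matrix (Fin (n + 1)) (Fin (n + 1)) F} (h : ∀ i : Fin n, M i.succ 0 = 0) :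
    M.det = M 0 0 * (M.submatrix Fin.succ Fin.succ).det := by
  rw [Matrix.det_succ_column_zero, Fin.sum_univ_succ]
  simp [h]

theorem Matrix.trace_eq_add_trace_submatrix {n : ℕ} (M : Matrix (Fin (n + 1)) (Fin (n + 1)) F) :
    M.trace = M 0 0 + (M.submatrix Fin.succ Fin.succ).trace := by
  simp [Matrix.trace, Fin.sum_univ_succ]

/-- The elementary column operation adding `v j` times column `0` to column `j + 1`. -/
def addColZero {n : ℕ} (v : Fin n → F) : Matrix (Fin (n + 1)) (Fin (n + 1)) F :=
  1 + Matrix.vecMulVec (Pi.single 0 1) (Fin.cons 0 v)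

theorem det_addColZero {n : ℕ} (v : Fin n → F) : (addColZero v).det = 1 := by
  have hsub : (addColZero v).submatrix Fin.succ Fin.succ = 1 := by
    ext i j
    simp [addColZero, Matrix.vecMulVec_apply, Matrix.one_apply]
  rw [Matrix.det_eq_mul_det_submatrix_of_col_zero, hsub]
  · simp [addColZero, Matrix.vecMulVec_apply]
  · simp [addColZero, Matrix.vecMulVec_apply]

theorem trace_mul_addColZero {n : ℕ} (M : Matrix (Fin (n + 1)) (Fin (n + 1)) F)
    (v : Fin n → F) :
    (M * addColZero v).trace = M.trace + (fun j : Fin n => M j.succ 0) ⬝ᵥ v := by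
  rw [addColZero, mul_add, mul_one, Matrix.trace_add, Matrix.mul_vecMulVec,
    Matrix.trace_vecMulVec, Matrix.mulVec_single_one]
  simp [dotProduct, Fin.sum_univ_succ]

/-- Splitting a square matrix into its corner, first row, first column and remaining block. -/
def matrixSuccEquiv (n : ℕ) :
    Matrix (Fin (n + 1)) (Fin (n + 1)) F ≃
      (F × (Fin n → F)) × (Fin n → F) × Matrix (Fin n) (Fin n) F where
  toFun M := ((M 0 0, fun j => M 0 j.succ), fun i => M i.succ 0, M.submatrix Fin.succ Fin.succ)
  invFun p := Fin.cons (Fin.cons p.1.1 p.1.2) fun i => Fin.cons (p.2.1 i) (p.2.2 i)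
  left_inv M := by
    ext i j
    refine Fin.cases ?_ (fun i => ?_) i <;> refine Fin.cases ?_ (fun j => ?_) j <;> rfl
  right_inv p := rfl

end MatrixBlocks

/-! ### Evaluation of the matrix Gauss sums -/

section MatrixSums

variable {F : Type*} [Field F] [Fintype F] [DecidableEq F]

theorem AddChar.sum_apply_dotProduct {ι : Type*} [Fintype ι] [DecidableEq ι]
    {ψ : AddChar F ℂ} (hψ : ψ ≠ 1) (c : ι → F) :
    ∑ v : ι → F, ψ (c ⬝ᵥ v) = if c = 0 then (Fintype.card F : ℂ) ^ Fintype.card ι else 0 := by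
  have hprod (v : ι → F) : ψ (c ⬝ᵥ v) = ∏ i, ψ (c i * v i) :=
    map_prod ψ.toMonoidHom (fun i => Multiplicative.ofAdd (c i * v i)) Finset.univ
  simp only [hprod]
  rw [← Fintype.prod_sum (fun i (x : F) => ψ (c i * x))]
  have h (i : ι) : ∑ x : F, ψ (c i * x) = if c i = 0 then (Fintype.card F : ℂ) else 0 := by
    simpa [mul_comm] using AddChar.sum_mulShift (c i) (AddChar.IsPrimitive.of_ne_one hψ)
  simp only [h]
  split_ifs with hc
  · simp [hc]
  · obtain ⟨i, hi⟩ := Function.ne_iff.mp hc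
    exact Finset.prod_eq_zero (Finset.mem_univ i) (if_neg hi)

/-- The sum of `χ(det M) ψ(tr M)` over all matrices; singular matrices contribute `0` as soon as
`n ≥ 1`. -/
noncomputable def matrixGaussSum (χ : MulChar F ℂ) (ψ : AddChar F ℂ) (n : ℕ) : ℂ :=
  ∑ M : Matrix (Fin n) (Fin n) F, χ M.det * ψ M.trace

theorem glGaussSum_eq_matrixGaussSum (χ : MulChar F ℂ) (ψ : AddChar F ℂ) (n : ℕ) :
    glGaussSum χ ψ n = matrixGaussSum χ ψ n := by
  refine Finset.sum_of_injOn (fun g : GL (Fin n) F => (g : Matrix (Fin n) (Fin n) F))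
    (fun _ _ _ _ h => Units.ext h) (by simp) (fun M _ hM => ?_) (fun _ _ => rfl)
  have hdet : ¬ IsUnit M.det := fun h => hM
    ⟨((Matrix.isUnit_iff_isUnit_det M).mpr h).unit, by simp, rfl⟩
  rw [χ.map_nonunit hdet, zero_mul]

theorem matrixGaussSum_succ (χ : MulChar F ℂ) {ψ : AddChar F ℂ} (hψ : ψ ≠ 1) (n : ℕ) :
    matrixGaussSum χ ψ (n + 1) =
      (Fintype.card F : ℂ) ^ n * gaussSum χ ψ * matrixGaussSum χ ψ n := by
  have hq : (Fintype.card F : ℂ) ^ n ≠ 0 :=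
    pow_ne_zero _ (Nat.cast_ne_zero.mpr Fintype.card_ne_zero)
  -- Reindex by right multiplication by a matrix of determinant one.
  have shift (v : Fin n → F) : matrixGaussSum χ ψ (n + 1) =
      ∑ M : Matrix (Fin (n + 1)) (Fin (n + 1)) F,
        χ M.det * ψ M.trace * ψ ((fun j : Fin n => M j.succ 0) ⬝ᵥ v) := by
    have hu : IsUnit (addColZero v) := by
      rw [Matrix.isUnit_iff_isUnit_det, det_addColZero]; exact isUnit_one
    rw [matrixGaussSum, ← Equiv.sum_comp (Units.mulRight hu.unit)]
    refine Finset.sum_congr rfl fun M _ => ?_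
    simp only [Units.mulRight_apply, IsUnit.unit_spec]
    rw [Matrix.det_mul, det_addColZero, mul_one, trace_mul_addColZero, AddChar.map_add_eq_mul,
      mul_assoc]
  -- Sum `shift` over all `q ^ n` vectors `v`; orthogonality returns the same factor `q ^ n`, which
  -- cancels.
  have supported : matrixGaussSum χ ψ (n + 1) =
      ∑ M : Matrix (Fin (n + 1)) (Fin (n + 1)) F,
        if (fun j : Fin n => M j.succ 0) = 0 then χ M.det * ψ M.trace else 0 := by
    refine mul_left_cancel₀ hq ?_
    have hsum : ∑ _v : Fin n → F, matrixGaussSum χ ψ (n + 1) =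
        (Fintype.card F : ℂ) ^ n * matrixGaussSum χ ψ (n + 1) := by simp
    rw [← hsum, Finset.sum_congr rfl fun v _ => shift v, Finset.sum_comm, Finset.mul_sum]
    refine Finset.sum_congr rfl fun M _ => ?_
    rw [← Finset.mul_sum, AddChar.sum_apply_dotProduct hψ]
    split_ifs <;> simp [mul_comm]
  rw [supported, ← Equiv.sum_comp (matrixSuccEquiv n).symm]
  have key (p : (F × (Fin n → F)) × (Fin n → F) × Matrix (Fin n) (Fin n) F) :
      (if (fun j : Fin n => (matrixSuccEquiv n).symm p j.succ 0) = 0 then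
        χ ((matrixSuccEquiv n).symm p).det * ψ ((matrixSuccEquiv n).symm p).trace else 0) =
      if p.2.1 = 0 then χ p.1.1 * ψ p.1.1 * (χ p.2.2.det * ψ p.2.2.trace) else 0 := by
    have hc : (fun j : Fin n => (matrixSuccEquiv n).symm p j.succ 0) = p.2.1 := rfl
    rw [hc]
    refine ite_congr rfl (fun h => ?_) fun _ => rfl
    rw [Matrix.det_eq_mul_det_submatrix_of_col_zero (fun i => congrFun (hc.trans h) i),
      Matrix.trace_eq_add_trace_submatrix, map_mul, AddChar.map_add_eq_mul]
    exact mul_mul_mul_comm _ _ _ _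
  simp only [key, Fintype.sum_prod_type]
  -- The summand ignores the first row, whose `q ^ n` choices give the power of `q`.
  simp only [Finset.sum_ite_irrel, Finset.sum_const_zero, Finset.sum_ite_eq', Finset.mem_univ,
    if_true, ← Finset.mul_sum, Finset.sum_const, Finset.card_univ,
    Fintype.card_fun, Fintype.card_fin, nsmul_eq_mul, Nat.cast_pow]
  rw [← Finset.sum_mul, gaussSum, matrixGaussSum]
  ring

theorem matrixGaussSum_eq (χ : MulChar F ℂ) {ψ : AddChar F ℂ} (hψ : ψ ≠ 1) (n : ℕ) :
    matrixGaussSum χ ψ n = (Fintype.card F : ℂ) ^ (n.choose 2) * gaussSum χ ψ ^ n := by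
  induction n with
  | zero =>
    rw [matrixGaussSum, Fintype.sum_subsingleton _ 1]
    simp
  | succ n ih =>
    rw [matrixGaussSum_succ χ hψ, ih, Nat.choose_succ_succ' n 1, Nat.choose_one_right]
    ring

theorem glGaussSum_eq (χ : MulChar F ℂ) {ψ : AddChar F ℂ} (hψ : ψ ≠ 1) (n : ℕ) :
    glGaussSum χ ψ n = (Fintype.card F : ℂ) ^ (n.choose 2) * gaussSum χ ψ ^ n := by
  rw [glGaussSum_eq_matrixGaussSum, matrixGaussSum_eq χ hψ]

theorem glGaussSum_one_one (n : ℕ) :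
    glGaussSum (1 : MulChar F ℂ) (1 : AddChar F ℂ) n = Fintype.card (GL (Fin n) F) := by
  have h (g : GL (Fin n) F) : (1 : MulChar F ℂ) (Matrix.det (g : Matrix (Fin n) (Fin n) F)) = 1 :=
    MulChar.one_apply ((Matrix.isUnit_iff_isUnit_det _).mp g.isUnit)
  simp [glGaussSum, h]

/-- Translating by `diag(a, 1, ..., 1)` with `χ a ≠ 1` multiplies the sum by `χ a`; `1 ≤ n` leaves
room for the entry `a`. -/
theorem glGaussSum_one_of_ne_one {χ : MulChar F ℂ} (hχ : χ ≠ 1) {n : ℕ} (hn : 1 ≤ n) :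
    glGaussSum χ (1 : AddChar F ℂ) n = 0 := by
  obtain ⟨a, ha⟩ := MulChar.ne_one_iff.mp hχ
  obtain ⟨m, rfl⟩ := Nat.exists_eq_add_of_le' hn
  have hdet : (Matrix.diagonal (Fin.cons (a : F) fun _ : Fin m => 1)).det = (a : F) := by
    simp [Matrix.det_diagonal, Fin.prod_univ_succ]
  have hu : IsUnit (Matrix.diagonal (Fin.cons (a : F) fun _ : Fin m => 1)) := by
    rw [Matrix.isUnit_iff_isUnit_det, hdet]; exact a.isUnit
  have h : χ a * glGaussSum χ (1 : AddChar F ℂ) (m + 1) =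
      glGaussSum χ (1 : AddChar F ℂ) (m + 1) := by
    conv_rhs => rw [glGaussSum, ← Equiv.sum_comp (Equiv.mulLeft hu.unit)]
    rw [glGaussSum, Finset.mul_sum]
    refine Finset.sum_congr rfl fun g _ => ?_
    simp [hdet]
  by_contra h0
  exact ha (mul_right_cancel₀ h0 (h.trans (one_mul _).symm))

end MatrixSums

/-! ### Euler's product from the recurrence, analytic and formal -/

section EulerProduct

open Filter Topology

variable {q c : ℂ} {a : ℕ → ℂ}

theorem norm_inv_lt_one_of_one_lt (hq : 1 < ‖q‖) : ‖q⁻¹‖ < 1 := by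
  rw [norm_inv]; exact inv_lt_one_of_one_lt₀ hq

theorem tendsto_inv_pow_zero (hq : 1 < ‖q‖) : Tendsto (fun N : ℕ => q⁻¹ ^ N) atTop (𝓝 0) :=
  tendsto_pow_atTop_nhds_zero_of_norm_lt_one (norm_inv_lt_one_of_one_lt hq)

theorem summable_norm_div_pow_succ (hq : 1 < ‖q‖) (c : ℂ) :
    Summable fun i : ℕ => ‖c / q ^ (i + 1)‖ := by
  have h := (summable_geometric_of_lt_one (norm_nonneg _) (norm_inv_lt_one_of_one_lt hq)).mul_left
    ‖c / q‖
  refine h.congr fun i => ?_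
  rw [← norm_pow, ← norm_mul, pow_succ, inv_pow, div_mul_eq_div_div_swap, div_eq_mul_inv (c / q)]

theorem summable_mul_pow_of_recurrence (hq : 1 < ‖q‖)
    (ha : ∀ n, (q ^ (n + 1) - 1) * a (n + 1) = c * a n) (u : ℂ) :
    Summable fun n => a n * u ^ n := by
  refine summable_of_ratio_norm_eventually_le (r := 1 / 2) (by norm_num) ?_
  have hlim : Tendsto (fun n : ℕ => ‖q‖ ^ (n + 1)) atTop atTop :=
    (tendsto_pow_atTop_atTop_of_one_lt hq).comp (tendsto_add_atTop_nat 1)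
  -- The threshold keeps `‖q ^ (n + 1) - 1‖` positive and at least `2 ‖c u‖`, so the term ratio is
  -- at most `1 / 2`.
  filter_upwards [hlim.eventually_ge_atTop (2 * (‖c‖ * ‖u‖) + 2)] with n hn
  have hlow : 2 * (‖c‖ * ‖u‖) + 1 ≤ ‖q ^ (n + 1) - 1‖ := by
    have := norm_sub_norm_le (q ^ (n + 1)) 1
    rw [norm_pow, norm_one] at this
    linarith
  have hrec : ‖q ^ (n + 1) - 1‖ * ‖a (n + 1)‖ = ‖c‖ * ‖a n‖ := by
    rw [← norm_mul, ha, norm_mul]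
  have hcu : 0 ≤ ‖c‖ * ‖u‖ := by positivity
  refine le_of_mul_le_mul_left ?_ (show 0 < ‖q ^ (n + 1) - 1‖ by linarith)
  calc ‖q ^ (n + 1) - 1‖ * ‖a (n + 1) * u ^ (n + 1)‖
      = (‖q ^ (n + 1) - 1‖ * ‖a (n + 1)‖) * ‖u‖ ^ (n + 1) := by
        rw [norm_mul, norm_pow, mul_assoc]
    _ = (‖c‖ * ‖u‖) * (‖a n‖ * ‖u‖ ^ n) := by rw [hrec]; ring
    _ ≤ (‖q ^ (n + 1) - 1‖ * (1 / 2)) * (‖a n‖ * ‖u‖ ^ n) := by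
        exact mul_le_mul_of_nonneg_right (by linarith) (by positivity)
    _ = ‖q ^ (n + 1) - 1‖ * (1 / 2 * ‖a n * u ^ n‖) := by
        rw [norm_mul, norm_pow, mul_assoc]

/-- Write the recurrence as `q ^ (n + 1) a (n + 1) = a (n + 1) + c a n`, multiply by `(u / q) ^ (n +
1)` and sum. -/
theorem tsum_mul_pow_eq_mul_tsum_div (hq : 1 < ‖q‖)
    (ha : ∀ n, (q ^ (n + 1) - 1) * a (n + 1) = c * a n) (u : ℂ) :
    ∑' n, a n * u ^ n = (1 + u * c / q) * ∑' n, a n * (u / q) ^ n := by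
  have hq0 : q ≠ 0 := norm_pos_iff.mp (zero_lt_one.trans hq)
  have hs := summable_mul_pow_of_recurrence hq ha
  have hterm (n : ℕ) : a (n + 1) * u ^ (n + 1) =
      a (n + 1) * (u / q) ^ (n + 1) + u * c / q * (a n * (u / q) ^ n) := by
    have h := ha n
    have hu : u ^ (n + 1) = q ^ (n + 1) * (u / q) ^ (n + 1) := by
      rw [← mul_pow, mul_div_cancel₀ _ hq0]
    have hu' : u * c / q * (a n * (u / q) ^ n) = c * a n * (u / q) ^ (n + 1) := by
      rw [pow_succ]; ring
    rw [hu', ← h, hu]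
    ring
  rw [(hs u).tsum_eq_zero_add, tsum_congr hterm,
    ((summable_nat_add_iff 1).mpr (hs (u / q))).tsum_add ((hs (u / q)).mul_left _),
    tsum_mul_left, add_mul, one_mul, ← add_assoc]
  congr 1
  rw [(hs (u / q)).tsum_eq_zero_add]
  simp

theorem tsum_mul_pow_eq_prod_mul_tsum (hq : 1 < ‖q‖)
    (ha : ∀ n, (q ^ (n + 1) - 1) * a (n + 1) = c * a n) (u : ℂ) (N : ℕ) :
    ∑' n, a n * u ^ n =
      (∏ i ∈ Finset.range N, (1 + u * c / q ^ (i + 1))) * ∑' n, a n * (u * q⁻¹ ^ N) ^ n := by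
  induction N with
  | zero => simp
  | succ N ih =>
    rw [ih, tsum_mul_pow_eq_mul_tsum_div hq ha, Finset.prod_range_succ]
    have h₁ : u * q⁻¹ ^ N * c / q = u * c / q ^ (N + 1) := by
      rw [inv_pow, pow_succ]; field_simp
    have h₂ : u * q⁻¹ ^ N / q = u * q⁻¹ ^ (N + 1) := by
      rw [pow_succ, div_eq_mul_inv, mul_assoc]
    rw [h₁, h₂, mul_assoc]

/-- Dominated convergence with bound `‖a n * u ^ n‖`, as `‖q⁻¹ ^ N‖ ≤ 1`. -/
theorem tendsto_tsum_mul_pow_nhds_one (hq : 1 < ‖q‖) (h0 : a 0 = 1)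
    (ha : ∀ n, (q ^ (n + 1) - 1) * a (n + 1) = c * a n) (u : ℂ) :
    Tendsto (fun N : ℕ => ∑' n, a n * (u * q⁻¹ ^ N) ^ n) atTop (𝓝 1) := by
  have hsum : ∑' n : ℕ, a n * (0 : ℂ) ^ n = 1 := by
    rw [tsum_eq_single 0 fun n hn => by simp [hn]]
    simp [h0]
  rw [← hsum]
  refine tendsto_tsum_of_dominated_convergence (summable_mul_pow_of_recurrence hq ha u).norm
    (fun n => ?_) (Eventually.of_forall fun N n => ?_)
  · have h : Tendsto (fun N : ℕ => u * q⁻¹ ^ N) atTop (𝓝 0) := by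
      simpa using (tendsto_inv_pow_zero hq).const_mul u
    exact (h.pow n).const_mul (a n)
  · rw [norm_mul, norm_mul, norm_pow, norm_pow, norm_mul, norm_pow]
    gcongr
    exact mul_le_of_le_one_right (norm_nonneg _)
      (pow_le_one₀ (norm_nonneg _) (norm_inv_lt_one_of_one_lt hq).le)

theorem multipliable_one_add_mul_div_pow (hq : 1 < ‖q‖) (c u : ℂ) :
    Multipliable fun i : ℕ => 1 + u * c / q ^ (i + 1) :=
  multipliable_one_add_of_summable (summable_norm_div_pow_succ hq (u * c))

/-- Euler's product expansion in a complex variable. -/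
theorem hasSum_mul_pow_tprod (hq : 1 < ‖q‖) (h0 : a 0 = 1)
    (ha : ∀ n, (q ^ (n + 1) - 1) * a (n + 1) = c * a n) (u : ℂ) :
    HasSum (fun n => a n * u ^ n) (∏' i : ℕ, (1 + u * c / q ^ (i + 1))) := by
  have hlim := ((multipliable_one_add_mul_div_pow hq c u).hasProd.tendsto_prod_nat).mul
    (tendsto_tsum_mul_pow_nhds_one hq h0 ha u)
  -- Partial product times remainder does not depend on `N`, so its limit is the series itself.
  simp only [← tsum_mul_pow_eq_prod_mul_tsum hq ha, mul_one] at hlim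
  rw [← tendsto_nhds_unique tendsto_const_nhds hlim]
  exact (summable_mul_pow_of_recurrence hq ha u).hasSum

/-- A product of linear power series converges coefficientwise when its coefficients are absolutely
summable. -/
theorem PowerSeries.multipliable_one_add_C_mul_X {ι : Type*} {z : ι → ℂ}
    (hz : Summable fun i => ‖z i‖) :
    Multipliable fun i => (1 : ℂ⟦X⟧) + PowerSeries.C (z i) * PowerSeries.X := by
  refine multipliable_one_add_of_summable_prod ?_
  rw [PowerSeries.WithPiTopology.summable_iff_summable_coeff]
  intro d
  -- The term of a finite set `s` is `∏ z i` times `X ^ |s|`, so each of its coefficients is bounded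
  -- by `∏ ‖z i‖`.
  refine (summable_finsetProd_of_summable_norm hz).norm.of_norm_bounded fun s => ?_
  rw [Finset.prod_mul_distrib, Finset.prod_const, ← map_prod, PowerSeries.coeff_C_mul,
    PowerSeries.coeff_X_pow]
  split_ifs
  · simp
  · simpa using Finset.prod_nonneg fun i _ => norm_nonneg (z i)

theorem PowerSeries.mk_eq_prod_mul_rescale (hq : 1 < ‖q‖)
    (ha : ∀ n, (q ^ (n + 1) - 1) * a (n + 1) = c * a n) (N : ℕ) :
    PowerSeries.mk a =
      (∏ i ∈ Finset.range N,
        ((1 : ℂ⟦X⟧) + PowerSeries.C (c / q ^ (i + 1)) * PowerSeries.X)) *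
      PowerSeries.rescale (q⁻¹ ^ N) (PowerSeries.mk a) := by
  have hq0 : q ≠ 0 := norm_pos_iff.mp (zero_lt_one.trans hq)
  have hstep : PowerSeries.mk a =
      (1 + PowerSeries.C (c / q) * PowerSeries.X) *
        PowerSeries.rescale q⁻¹ (PowerSeries.mk a) := by
    ext n
    rw [add_mul, one_mul, mul_assoc, map_add, PowerSeries.coeff_C_mul]
    cases n with
    | zero => simp
    | succ n =>
      rw [PowerSeries.coeff_succ_X_mul, PowerSeries.coeff_rescale, PowerSeries.coeff_rescale,
        PowerSeries.coeff_mk, PowerSeries.coeff_mk]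
      have h := ha n
      have hu : a (n + 1) = q⁻¹ ^ (n + 1) * (q ^ (n + 1) * a (n + 1)) := by
        rw [← mul_assoc, ← mul_pow, inv_mul_cancel₀ hq0, one_pow, one_mul]
      have hv : c / q * (q⁻¹ ^ n * a n) = q⁻¹ ^ (n + 1) * (c * a n) := by
        rw [pow_succ]; ring
      rw [hv, ← h]
      nth_rewrite 1 [hu]
      ring
  induction N with
  | zero => simp
  | succ N ih =>
    have hC : PowerSeries.rescale (q⁻¹ ^ N) (PowerSeries.C (c / q)) = PowerSeries.C (c / q) := by
      ext n
      rw [PowerSeries.coeff_rescale, PowerSeries.coeff_C]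
      split_ifs with hn <;> simp [hn]
    have h := congrArg (PowerSeries.rescale (q⁻¹ ^ N)) hstep
    rw [map_mul, map_add, map_one, map_mul, PowerSeries.rescale_X, PowerSeries.rescale_rescale,
      hC, ← mul_assoc, ← map_mul, ← pow_succ'] at h
    rw [Finset.prod_range_succ, mul_assoc]
    have hc : c / q ^ (N + 1) = c / q * q⁻¹ ^ N := by
      rw [inv_pow, pow_succ]; field_simp
    rw [hc, ← h]
    exact ih

/-- Euler's product expansion as an identity of formal power series. -/
theorem PowerSeries.hasProd_mk_of_recurrence (hq : 1 < ‖q‖) (h0 : a 0 = 1)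
    (ha : ∀ n, (q ^ (n + 1) - 1) * a (n + 1) = c * a n) :
    HasProd (fun i : ℕ => (1 : ℂ⟦X⟧) + PowerSeries.C (c / q ^ (i + 1)) * PowerSeries.X)
      (PowerSeries.mk a) := by
  have hm := PowerSeries.multipliable_one_add_C_mul_X (summable_norm_div_pow_succ hq c)
  -- Coefficient `d` is scaled by `q⁻¹ ^ (N d)`, so only the constant term survives in the limit.
  have hone : Tendsto (fun N : ℕ => PowerSeries.rescale (q⁻¹ ^ N) (PowerSeries.mk a))
      atTop (𝓝 1) := by
    rw [PowerSeries.WithPiTopology.tendsto_iff_coeff_tendsto]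
    intro d
    simp only [PowerSeries.coeff_rescale, PowerSeries.coeff_mk, PowerSeries.coeff_one]
    have h := ((tendsto_inv_pow_zero hq).pow d).mul_const (a d)
    split_ifs with hd
    · subst hd; simp [h0]
    · simpa [hd] using h
  have hlim := hm.hasProd.tendsto_prod_nat.mul hone
  simp only [← PowerSeries.mk_eq_prod_mul_rescale hq ha, mul_one] at hlim
  rw [tendsto_nhds_unique tendsto_const_nhds hlim]
  exact hm.hasProd

end EulerProduct

theorem one_lt_norm_card {F : Type*} [Field F] [Fintype F] : 1 < ‖(Fintype.card F : ℂ)‖ := by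
  rw [Complex.norm_natCast]
  exact_mod_cast Fintype.one_lt_card

/-! ### Orders of the general linear groups and the generating function -/

section GeneratingFunction

variable {F : Type*} [Field F] [Fintype F] [DecidableEq F]

/-- In `∏ (q ^ (n + 1) - q ^ i)` the factor `i = 0` splits off, and each of the other `n` is `q`
times a factor for `n`. -/
theorem card_GL_succ (n : ℕ) :
    (Fintype.card (GL (Fin (n + 1)) F) : ℂ) =
      ((Fintype.card F : ℂ) ^ (n + 1) - 1) * (Fintype.card F : ℂ) ^ n *
        Fintype.card (GL (Fin n) F) := by
  have hcard (m : ℕ) : (Fintype.card (GL (Fin m) F) : ℂ) =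
      ∏ i : Fin m, ((Fintype.card F : ℂ) ^ m - (Fintype.card F : ℂ) ^ (i : ℕ)) := by
    rw [← Nat.card_eq_fintype_card, Matrix.card_GL_field, Nat.cast_prod]
    refine Finset.prod_congr rfl fun i _ => ?_
    rw [Nat.cast_sub (Nat.pow_le_pow_right Fintype.card_pos i.2.le), Nat.cast_pow, Nat.cast_pow]
  rw [hcard, hcard, Fin.prod_univ_succ]
  have h (i : Fin n) :
      (Fintype.card F : ℂ) ^ (n + 1) - (Fintype.card F : ℂ) ^ (i.succ : ℕ) =
        (Fintype.card F : ℂ) * ((Fintype.card F : ℂ) ^ n - (Fintype.card F : ℂ) ^ (i : ℕ)) := by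
    rw [Fin.val_succ]; ring
  simp only [h, Finset.prod_mul_distrib, Finset.prod_const, Finset.card_univ, Fintype.card_fin,
    Fin.val_zero, pow_zero, mul_assoc]

theorem card_GL_ne_zero (n : ℕ) : (Fintype.card (GL (Fin n) F) : ℂ) ≠ 0 :=
  Nat.cast_ne_zero.mpr Fintype.card_ne_zero

theorem glCoeff_eq_div (χ : MulChar F ℂ) {ψ : AddChar F ℂ} (hψ : ψ ≠ 1) (n : ℕ) :
    glCoeff χ ψ n = (Fintype.card F : ℂ) ^ (n.choose 2) * gaussSum χ ψ ^ n /
      Fintype.card (GL (Fin n) F) := by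
  rw [glCoeff]
  split_ifs with hn
  · subst hn; simp
  · rw [glGaussSum_eq χ hψ]

/-- The `q ^ n` gained by the Gauss sum cancels the one in `card_GL_succ`. -/
theorem glCoeff_recurrence (χ : MulChar F ℂ) {ψ : AddChar F ℂ} (hψ : ψ ≠ 1) (n : ℕ) :
    ((Fintype.card F : ℂ) ^ (n + 1) - 1) * glCoeff χ ψ (n + 1) =
      gaussSum χ ψ * glCoeff χ ψ n := by
  have hn := card_GL_ne_zero (F := F) n
  have hs := card_GL_ne_zero (F := F) (n + 1)
  rw [glCoeff_eq_div χ hψ, glCoeff_eq_div χ hψ, Nat.choose_succ_succ' n 1, Nat.choose_one_right,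
    mul_div_assoc', mul_div_assoc', div_eq_div_iff hs hn, card_GL_succ]
  ring

theorem glCoeff_one_one (n : ℕ) : glCoeff (1 : MulChar F ℂ) (1 : AddChar F ℂ) n = 1 := by
  rw [glCoeff, glGaussSum_one_one, div_self (card_GL_ne_zero n), ite_self]

theorem glCoeff_one_of_ne_one {χ : MulChar F ℂ} (hχ : χ ≠ 1) (n : ℕ) :
    glCoeff χ (1 : AddChar F ℂ) n = if n = 0 then 1 else 0 := by
  rw [glCoeff]
  refine ite_congr rfl (fun _ => rfl) fun hn => ?_
  rw [glGaussSum_one_of_ne_one hχ (Nat.one_le_iff_ne_zero.mpr hn), zero_div]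

theorem glSeries_one_one : glSeries (1 : MulChar F ℂ) (1 : AddChar F ℂ) =
    (1 - PowerSeries.X)⁻¹ := by
  rw [PowerSeries.eq_inv_iff_mul_eq_one (by simp), glSeries, funext glCoeff_one_one]
  exact PowerSeries.mk_one_mul_one_sub_eq_one ℂ

theorem glSeries_one_of_ne_one {χ : MulChar F ℂ} (hχ : χ ≠ 1) :
    glSeries χ (1 : AddChar F ℂ) = 1 := by
  ext n
  rw [glSeries, PowerSeries.coeff_mk, glCoeff_one_of_ne_one hχ, PowerSeries.coeff_one]

theorem hasSum_glCoeff_one_of_ne_one {χ : MulChar F ℂ} (hχ : χ ≠ 1) (u : ℂ) :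
    HasSum (fun n : ℕ => glCoeff χ (1 : AddChar F ℂ) n * u ^ n) 1 := by
  have h := hasSum_single (f := fun n : ℕ => glCoeff χ (1 : AddChar F ℂ) n * u ^ n) 0
    fun n hn => by rw [glCoeff_one_of_ne_one hχ, if_neg hn, zero_mul]
  simpa [glCoeff_one_of_ne_one hχ] using h

end GeneratingFunction

theorem theorem1 {F : Type*} [Field F] [Fintype F] [DecidableEq F]
    (χ : MulChar F ℂ) (ψ : AddChar F ℂ) :
    -- the generating function, as an identity of formal power series
    -- (infinite products converge coefficientwise)
    ((ψ = 1 → χ = 1 → glSeries χ ψ = (1 - PowerSeries.X)⁻¹) ∧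
      (ψ = 1 → χ ≠ 1 → glSeries χ ψ = 1) ∧
      (ψ ≠ 1 → HasProd
        (fun i : ℕ => (1 : ℂ⟦X⟧) +
          PowerSeries.C (gaussSum χ ψ / (Fintype.card F : ℂ) ^ (i + 1)) * PowerSeries.X)
        (glSeries χ ψ))) ∧
    -- the generating function, as an identity of convergent series in a complex variable
    ((ψ = 1 → χ = 1 → ∀ u : ℂ, ‖u‖ < 1 →
        HasSum (fun n : ℕ => glCoeff χ ψ n * u ^ n) (1 / (1 - u))) ∧
      (ψ = 1 → χ ≠ 1 → ∀ u : ℂ, HasSum (fun n : ℕ => glCoeff χ ψ n * u ^ n) 1) ∧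
      (ψ ≠ 1 → ∀ u : ℂ,
        Multipliable (fun i : ℕ =>
          1 + u * gaussSum χ ψ / (Fintype.card F : ℂ) ^ (i + 1)) ∧
        HasSum (fun n : ℕ => glCoeff χ ψ n * u ^ n)
          (∏' i : ℕ, (1 + u * gaussSum χ ψ / (Fintype.card F : ℂ) ^ (i + 1))))) ∧
    -- the closed form of the sums
    (∀ n : ℕ, 1 ≤ n →
      (ψ = 1 → χ = 1 → glGaussSum χ ψ n = (Fintype.card (GL (Fin n) F) : ℂ)) ∧
      (ψ = 1 → χ ≠ 1 → glGaussSum χ ψ n = 0) ∧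
      (ψ ≠ 1 → glGaussSum χ ψ n =
        (Fintype.card F : ℂ) ^ (n.choose 2) * gaussSum χ ψ ^ n)) := by
  have hq := one_lt_norm_card (F := F)
  have h0 : glCoeff χ ψ 0 = 1 := if_pos rfl
  refine ⟨⟨?_, ?_, ?_⟩, ⟨?_, ?_, ?_⟩, fun n hn => ⟨?_, ?_, ?_⟩⟩
  · rintro rfl rfl
    exact glSeries_one_one
  · rintro rfl hχ
    exact glSeries_one_of_ne_one hχ
  · intro hψ
    exact PowerSeries.hasProd_mk_of_recurrence hq h0 (glCoeff_recurrence χ hψ)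
  · rintro rfl rfl u hu
    simpa [glCoeff_one_one] using hasSum_geometric_of_norm_lt_one hu
  · rintro rfl hχ
    exact hasSum_glCoeff_one_of_ne_one hχ
  · intro hψ u
    exact ⟨multipliable_one_add_mul_div_pow hq _ u,
      hasSum_mul_pow_tprod hq h0 (glCoeff_recurrence χ hψ) u⟩
  · rintro rfl rfl
    exact glGaussSum_one_one n
  · rintro rfl hχ
    exact glGaussSum_one_of_ne_one hχ hn
  · exact fun hψ => glGaussSum_eq χ hψ n
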